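/- Let $X$ be a metric space and $R$ an associative ring with unit. For $S\subseteq X$ and $r\ge 0$ let $S[r]=\{x\in X: d(x,S)\le r\}$ (with $\emptyset[r]=\emptyset$) and let $x[r]$ be the closed ball of radius $r$ about $x$. An $X$-filtered $R$-module $F$ is a left $R$-module $F=F(X)$ together with submodules $F(S)\subseteq F$ for all $S\subseteq X$, such that $F(S)\subseteq F(T)$ whenever $S\subseteq T$, and $F(\emptyset)=0$. It is - *lean* if there is $D\ge 0$ with $F(S)\subseteq\sum_{x\in S}F(x[D])$ for all $S\subseteq X$; - *scattered* if there is $\delta\ge 0$ with $F(X)\subseteq\sum_{x\in X}F(x[\delta])$; - *insular* if there is $d\ge 0$ with $F(S)\cap F(U)\subseteq F(S[d]\cap U[d])$ for all $S,U\subseteq X$. An $R$-homomorphism $f\colon F\to F'$ of $X$-filtered $R$-modules is *bicontrolled* if there is $b\ge 0$ such that $f(F(S))\subseteq F'(S[b])$ and $f(F)\cap F'(S)\subseteq f(F(S[b]))$ for all $S\subseteq X$. The space $X$ is *coarsely coherent* (over $R$) if for every short exact sequence $$0\to E'\xrightarrow{f}E\xrightarrow{g}E''\to 0$$ of $X$-filtered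 $R$-modules in which $f$ and $g$ are bicontrolled, $E$ is lean and $E''$ is insular, the module $E'$ is scattered. The space $X$ has *finite asymptotic dimension* if there is an integer $n\ge 0$ such that for every $r>0$ there are $n+1$ families $\mathcal U_0,\dots,\mathcal U_n$ of subsets of $X$ which together cover $X$, such that, for each $i$, the diameters of the members of $\mathcal U_i$ have a common finite bound and any two points in distinct members of $\mathcal U_i$ are at distance greater than $r$. **Corollary.** Every metric space of finite asymptotic dimension is coarsely coherent over every ring $R$. -/

import Mathlib

universe u v w w'

namespace CoarseGeometry

/-- An `X`-filtered `R`-module with total module `M = F(X)`: a monotone assignment of submodules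
of `M` to the subsets of `X`, with value `0` on the empty set and value `M` on all of `X`. -/
structure FilteredModule (R : Type u) [Ring R] (X : Type v)
    (M : Type w) [AddCommGroup M] [Module R M] where
  filt : Set X → Submodule R M
  mono : Monotone filt
  filt_empty : filt ∅ = ⊥
  filt_univ : filt Set.univ = ⊤

section Modules

variable {R : Type u} [Ring R] {X : Type v} [MetricSpace X]
variable {M : Type w} [AddCommGroup M] [Module R M]
variable {N : Type w'} [AddCommGroup N] [Module R N]

/-- `F(S) ⊆ ∑_{x ∈ S} F(x[D])` for some `D ≥ 0` and all subsets `S`. -/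
def FilteredModule.LeanFiltered (F : FilteredModule R X M) : Prop :=
  ∃ D : ℝ, 0 ≤ D ∧ ∀ S : Set X, F.filt S ≤ ⨆ x ∈ S, F.filt (Metric.closedBall x D)

/-- `F(X) ⊆ ∑_{x ∈ X} F(x[δ])` for some `δ ≥ 0`. -/
def FilteredModule.IsScattered (F : FilteredModule R X M) : Prop :=
  ∃ δ : ℝ, 0 ≤ δ ∧ F.filt Set.univ ≤ ⨆ x : X, F.filt (Metric.closedBall x δ)

/-- `F(S) ∩ F(U) ⊆ F(S[d] ∩ U[d])` for some `d ≥ 0` and all subsets `S`, `U`.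
The enlargement `S[d]` is the set of points at distance at most `d` from `S`. -/
def FilteredModule.IsInsular (F : FilteredModule R X M) : Prop :=
  ∃ d : ℝ, 0 ≤ d ∧ ∀ S U : Set X,
    F.filt S ⊓ F.filt U ≤ F.filt (Metric.cthickening d S ∩ Metric.cthickening d U)

/-- For some `b ≥ 0` and all subsets `S`:
`f(F(S)) ⊆ F'(S[b])` and `f(F) ∩ F'(S) ⊆ f(F(S[b]))`. -/
def IsBicontrolled (F : FilteredModule R X M) (F' : FilteredModule R X N) (f : M →ₗ[R] N) :
    Prop :=
  ∃ b : ℝ, 0 ≤ b ∧ ∀ S : Set X,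
    (F.filt S).map f ≤ F'.filt (Metric.cthickening b S) ∧
    LinearMap.range f ⊓ F'.filt S ≤ (F.filt (Metric.cthickening b S)).map f

end Modules

/-- Coarse coherence of `X` with respect to the coefficient ring `R`: for every short exact
sequence `0 → E' → E → E'' → 0` of `X`-filtered `R`-modules with bicontrolled maps, `E` lean and
`E''` insular, the kernel `E'` is scattered. -/
def CoarselyCoherent (R : Type u) [Ring R] (X : Type v) [MetricSpace X] : Prop :=
  ∀ (M' M M'' : Type w) [AddCommGroup M'] [AddCommGroup M] [AddCommGroup M'']
    [Module R M'] [Module R M] [Module R M'']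
    (E' : FilteredModule R X M') (E : FilteredModule R X M) (E'' : FilteredModule R X M'')
    (f : M' →ₗ[R] M) (g : M →ₗ[R] M''),
    Function.Injective f → Function.Exact f g → Function.Surjective g →
    IsBicontrolled E' E f → IsBicontrolled E E'' g →
    E.LeanFiltered → E''.IsInsular → E'.IsScattered

/-- Distinct members of the family are at distance greater than `r` from each other. -/
def RDisjoint {X : Type v} [MetricSpace X] (r : ℝ) (𝒰 : Set (Set X)) : Prop :=
  ∀ U ∈ 𝒰, ∀ V ∈ 𝒰, U ≠ V → ∀ x ∈ U, ∀ y ∈ V, r < dist x y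

/-- The members of the family have a common bound on their diameters. -/
def UniformlyBounded {X : Type v} [MetricSpace X] (𝒰 : Set (Set X)) : Prop :=
  ∃ B : ℝ, ∀ U ∈ 𝒰, ∀ x ∈ U, ∀ y ∈ U, dist x y ≤ B

/-- `asdim X ≤ n`: for every `r > 0` there are `n + 1` uniformly bounded `r`-disjoint families of
subsets which together cover `X`. -/
def AsdimLE (X : Type v) [MetricSpace X] (n : ℕ) : Prop :=
  ∀ r : ℝ, 0 < r → ∃ 𝒰 : Fin (n + 1) → Set (Set X),
    (∀ i, RDisjoint r (𝒰 i)) ∧ (∀ i, UniformlyBounded (𝒰 i)) ∧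
    ∀ x : X, ∃ i, ∃ U ∈ 𝒰 i, x ∈ U

/-- `X` has finite asymptotic dimension. -/
def FiniteAsdim (X : Type v) [MetricSpace X] : Prop :=
  ∃ n : ℕ, AsdimLE X n

end CoarseGeometry

namespace CoarseGeometry

open Metric Set

section Thickenings

variable {X : Type v} [MetricSpace X]

/-! Filter `ker g` by its intersections with `E.filt S`. Insularity of `E''` lets kernel elements
split, up to enlargement, over finite unions (`exists_ker_inf_filt_iUnion_fin_le`) and over families
that are disjoint enough (`exists_ker_inf_filt_iUnion_le`). Finite asymptotic dimension covers `X`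
by `n + 1` such families with bounded members, so every kernel element is a sum of kernel elements
with uniformly bounded support, and these pull back along `f`. -/

theorem exists_dist_lt_of_mem_cthickening {S : Set X} {t t' : ℝ} (ht : 0 ≤ t) (h : t < t') {x : X}
    (hx : x ∈ cthickening t S) : ∃ y ∈ S, dist x y < t' :=
  mem_thickening_iff.1 (cthickening_subset_thickening' (ht.trans_lt h) h S hx)

/-- The slack `t < t'` is needed because the distance to an infinite union need not be the distance
to any one piece. -/
theorem cthickening_iUnion_subset {ι : Type*} (A : ι → Set X) {t t' : ℝ} (ht : 0 ≤ t)
    (h : t < t') : cthickening t (⋃ i, A i) ⊆ ⋃ i, cthickening t' (A i) := by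
  intro x hx
  obtain ⟨y, hy, hxy⟩ := exists_dist_lt_of_mem_cthickening ht h hx
  obtain ⟨i, hi⟩ := mem_iUnion.1 hy
  exact mem_iUnion.2 ⟨i, mem_cthickening_of_dist_le x y _ _ hi hxy.le⟩

theorem cthickening_inter_cthickening_eq_empty {S T : Set X} {t : ℝ} (ht : 0 ≤ t)
    (h : ∀ x ∈ S, ∀ y ∈ T, 2 * t + 2 < dist x y) : cthickening t S ∩ cthickening t T = ∅ := by
  refine eq_empty_of_forall_notMem fun z ⟨hS, hT⟩ => ?_
  obtain ⟨x, hx, hzx⟩ := exists_dist_lt_of_mem_cthickening ht (lt_add_one t) hS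
  obtain ⟨y, hy, hzy⟩ := exists_dist_lt_of_mem_cthickening ht (lt_add_one t) hT
  have := dist_triangle_left x y z
  linarith [h x hx y hy]

end Thickenings

section Kernels

variable {R : Type u} [Ring R] {X : Type v} [MetricSpace X]
variable {M : Type*} [AddCommGroup M] [Module R M]
variable {N : Type*} [AddCommGroup N] [Module R N]

theorem FilteredModule.filt_iUnion_le {F : FilteredModule R X M} {D : ℝ}
    (hF : ∀ S : Set X, F.filt S ≤ ⨆ x ∈ S, F.filt (closedBall x D))
    {ι : Type*} (A : ι → Set X) :
    F.filt (⋃ i, A i) ≤ ⨆ i, F.filt (cthickening D (A i)) := by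
  refine (hF _).trans (iSup₂_le fun x hx => ?_)
  obtain ⟨i, hi⟩ := mem_iUnion.1 hx
  exact (F.mono (closedBall_subset_cthickening hi D)).trans
    (le_iSup (fun i => F.filt (cthickening D (A i))) i)

theorem FilteredModule.filt_union_le {F : FilteredModule R X M} {D : ℝ}
    (hF : ∀ S : Set X, F.filt S ≤ ⨆ x ∈ S, F.filt (closedBall x D)) (S T : Set X) :
    F.filt (S ∪ T) ≤ F.filt (cthickening D S) ⊔ F.filt (cthickening D T) := by
  refine (hF _).trans (iSup₂_le fun x hx => ?_)
  rcases hx with hx | hx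
  · exact (F.mono (closedBall_subset_cthickening hx D)).trans le_sup_left
  · exact (F.mono (closedBall_subset_cthickening hx D)).trans le_sup_right

variable {E : FilteredModule R X M} {E'' : FilteredModule R X N} {g : M →ₗ[R] N}

/-- Elements of the kernel supported on a union of two sets split inside the kernel. -/
theorem exists_ker_inf_filt_union_le
    (hg : IsBicontrolled E E'' g) (hE : E.LeanFiltered) (hE'' : E''.IsInsular) :
    ∃ c : ℝ, 0 ≤ c ∧ ∀ S T : Set X, LinearMap.ker g ⊓ E.filt (S ∪ T) ≤
      (LinearMap.ker g ⊓ E.filt (cthickening c S)) ⊔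
        (LinearMap.ker g ⊓ E.filt (cthickening c T)) := by
  obtain ⟨b, hb, hg⟩ := hg
  obtain ⟨D, hD, hE⟩ := hE
  obtain ⟨d, hd, hE''⟩ := hE''
  have thick (S : Set X) : cthickening b (cthickening d (cthickening b (cthickening D S))) ⊆
      cthickening (b + (d + (b + D))) S :=
    (cthickening_subset_of_subset b ((cthickening_subset_of_subset d
      (cthickening_cthickening_subset hb hD S)).trans
      (cthickening_cthickening_subset hd (by positivity) S))).trans
      (cthickening_cthickening_subset hb (by positivity) S)
  have thick' (S : Set X) : cthickening D S ⊆ cthickening (b + (d + (b + D))) S :=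
    cthickening_mono (by linarith) S
  refine ⟨b + (d + (b + D)), by positivity, fun S T k hk => ?_⟩
  obtain ⟨hk0, hk⟩ := hk
  obtain ⟨s, hs, t, ht, rfl⟩ := Submodule.mem_sup.1 (FilteredModule.filt_union_le hE S T hk)
  have hst : g s = g (-t) := by
    have h : g (s + t) = 0 := hk0
    rw [map_add] at h
    rw [map_neg, eq_neg_of_add_eq_zero_left h]
  have h1 := (hg _).1 (Submodule.mem_map_of_mem hs)
  have h2 := (hg _).1 (Submodule.mem_map_of_mem (neg_mem ht))
  rw [← hst] at h2
  -- The common value `g s = g (-t)` lives near both `S` and `T`, so it lifts to some `c` supported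
  -- near both. Correcting by `c` moves both summands into the kernel.
  obtain ⟨c, hc, hcs⟩ := (hg _).2 ⟨⟨s, rfl⟩, hE'' _ _ ⟨h1, h2⟩⟩
  refine Submodule.mem_sup.2 ⟨s - c, ⟨?_, sub_mem (E.mono (thick' S) hs) ?_⟩,
    t + c, ⟨?_, add_mem (E.mono (thick' T) ht) ?_⟩, by abel⟩
  · exact LinearMap.mem_ker.2 (by rw [map_sub, hcs, sub_self])
  · exact E.mono ((cthickening_subset_of_subset b inter_subset_left).trans (thick S)) hc
  · exact LinearMap.mem_ker.2 (by rw [map_add, hcs, hst, map_neg, add_neg_cancel])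
  · exact E.mono ((cthickening_subset_of_subset b inter_subset_right).trans (thick T)) hc

/-- Elements of the kernel split over finite unions, with control depending only on the number
of sets. -/
theorem exists_ker_inf_filt_iUnion_fin_le
    (hg : IsBicontrolled E E'' g) (hE : E.LeanFiltered) (hE'' : E''.IsInsular) (n : ℕ) :
    ∃ c : ℝ, 0 ≤ c ∧ ∀ A : Fin n → Set X, LinearMap.ker g ⊓ E.filt (⋃ i, A i) ≤
      ⨆ i, LinearMap.ker g ⊓ E.filt (cthickening c (A i)) := by
  obtain ⟨c, hc, h⟩ := exists_ker_inf_filt_union_le hg hE hE''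
  induction n with
  | zero => exact ⟨0, le_rfl, fun A => by simp [E.filt_empty]⟩
  | succ n ih =>
    obtain ⟨C, hC, ih⟩ := ih
    refine ⟨C + (c + 1), by positivity, fun A => ?_⟩
    have hA : ⋃ i, A i = A 0 ∪ ⋃ i : Fin n, A i.succ := by
      ext x; simp [Fin.exists_fin_succ]
    rw [hA]
    refine (h _ _).trans (sup_le ?_ ?_)
    · exact (inf_le_inf_left _ (E.mono (cthickening_mono (by linarith) _))).trans
        (le_iSup (fun i => LinearMap.ker g ⊓ E.filt (cthickening (C + (c + 1)) (A i))) 0)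
    · refine (inf_le_inf_left _ (E.mono
        (cthickening_iUnion_subset _ hc (lt_add_one c)))).trans ((ih _).trans
        (iSup_le fun i => ?_))
      exact (inf_le_inf_left _ (E.mono
        (cthickening_cthickening_subset hC (by positivity) _))).trans
        (le_iSup (fun i => LinearMap.ker g ⊓ E.filt (cthickening (C + (c + 1)) (A i))) i.succ)

/-- Elements of the kernel split over unions of sufficiently disjoint families. -/
theorem exists_ker_inf_filt_iUnion_le (hg : IsBicontrolled E E'' g) (hE : E.LeanFiltered)
    (hE'' : E''.IsInsular) :
    ∃ c r : ℝ, 0 ≤ c ∧ 0 ≤ r ∧ ∀ {ι : Type v} (A : ι → Set X),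
      (∀ i j, i ≠ j → ∀ x ∈ A i, ∀ y ∈ A j, r < dist x y) →
      LinearMap.ker g ⊓ E.filt (⋃ i, A i) ≤
        ⨆ i, LinearMap.ker g ⊓ E.filt (cthickening c (A i)) := by
  obtain ⟨b, hb, hg⟩ := hg
  obtain ⟨D, hD, hE⟩ := hE
  obtain ⟨d, hd, hE''⟩ := hE''
  -- This separation keeps the `(d + (b + D))`-enlargements of the pieces disjoint; the final `2` is
  -- slack for distances not attained.
  refine ⟨D, 2 * (d + (b + D)) + 2, hD, by positivity, fun {ι} A hA k hk => ?_⟩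
  classical
  obtain ⟨hk0, hk⟩ := hk
  obtain ⟨φ, hφ, rfl⟩ := (Submodule.mem_iSup_iff_exists_finsupp _ _).1
    (FilteredModule.filt_iUnion_le hE A hk)
  have thick (S : Set X) : cthickening d (cthickening b (cthickening D S)) ⊆
      cthickening (d + (b + D)) S :=
    (cthickening_subset_of_subset d (cthickening_cthickening_subset hb hD S)).trans
      (cthickening_cthickening_subset hd (by positivity) S)
  -- No correction is needed here: `g (φ i)` is supported near `A i` and near the other pieces,
  -- hence on the empty set, so it vanishes.
  refine Submodule.sum_mem _ fun i hi => Submodule.mem_iSup_of_mem i ⟨?_, hφ i⟩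
  have hsum : φ.sum (fun _ x => x) = φ i + ∑ j ∈ φ.support.erase i, φ j :=
    (Finset.add_sum_erase _ _ hi).symm
  set m := ∑ j ∈ φ.support.erase i, φ j with hm
  have hmem : m ∈ E.filt (cthickening D (⋃ j : {j // j ≠ i}, A j)) := by
    refine Submodule.sum_mem _ fun j hj => E.mono (cthickening_subset_of_subset D ?_) (hφ j)
    exact subset_iUnion (fun j : {j // j ≠ i} => A j) ⟨j, (Finset.mem_erase.1 hj).1⟩
  have him : g (φ i) = g (-m) := by
    have h : g (φ i + m) = 0 := hsum ▸ LinearMap.mem_ker.1 hk0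
    rw [map_add] at h
    rw [map_neg, eq_neg_of_add_eq_zero_left h]
  have h1 := (hg _).1 (Submodule.mem_map_of_mem (hφ i))
  have h2 := (hg _).1 (Submodule.mem_map_of_mem (neg_mem hmem))
  rw [← him] at h2
  have h3 := E''.mono (inter_subset_inter (thick _) (thick _)) (hE'' _ _ ⟨h1, h2⟩)
  rw [cthickening_inter_cthickening_eq_empty (by positivity), E''.filt_empty] at h3
  · exact h3
  · intro x hx y hy
    obtain ⟨⟨j, hj⟩, hy⟩ := mem_iUnion.1 hy
    exact hA i j hj.symm x hx y hy

end Kernels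

end CoarseGeometry

open CoarseGeometry Metric Set in
theorem mainTheorem11 (R : Type u) [Ring R] (X : Type v) [MetricSpace X]
    (hX : CoarseGeometry.FiniteAsdim X) :
    CoarseGeometry.CoarselyCoherent.{u, v, w} R X := by
  intro M' M M'' _ _ _ _ _ _ E' E E'' f g hf hfg _ hfc hg hE hE''
  obtain ⟨n, hn⟩ := hX
  obtain ⟨C, hC, hfin⟩ := exists_ker_inf_filt_iUnion_fin_le hg hE hE'' (n + 1)
  obtain ⟨c, r, hc, hr, hdisj⟩ := exists_ker_inf_filt_iUnion_le hg hE hE''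
  obtain ⟨b, hb, hfc⟩ := hfc
  -- `C` depends only on `n`, so the cover can be chosen after it, with members still `r`-disjoint
  -- once enlarged by `C + 1`.
  obtain ⟨𝒰, hU, hB, hcov⟩ := hn (r + 2 * (C + 2)) (by positivity)
  choose B hB using hB
  obtain ⟨β, hβ⟩ := (Set.finite_range B).bddAbove
  have hβ (i) : B i ≤ β := hβ ⟨i, rfl⟩
  set δ := |β| + (b + (c + (C + 1)) + 1) with hδ
  refine ⟨δ, by positivity, ?_⟩
  have hU' (i) : LinearMap.ker g ⊓ E.filt (cthickening C (⋃ U : 𝒰 i, (U : Set X))) ≤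
      (⨆ x : X, E'.filt (closedBall x δ)).map f := by
    refine (inf_le_inf_left _ (E.mono
      (cthickening_iUnion_subset _ hC (lt_add_one C)))).trans ((hdisj _ ?_).trans
      (iSup_le fun U => ?_))
    · intro U V hUV x hx y hy
      obtain ⟨x', hx', hxx⟩ :=
        exists_dist_lt_of_mem_cthickening (by positivity) (lt_add_one (C + 1)) hx
      obtain ⟨y', hy', hyy⟩ :=
        exists_dist_lt_of_mem_cthickening (by positivity) (lt_add_one (C + 1)) hy
      have h1 := hU i U U.2 V V.2 (fun h => hUV (Subtype.ext h)) x' hx' y' hy'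
      have h2 := dist_triangle4 x' x y y'
      rw [dist_comm x' x] at h2
      linarith
    · have hker : LinearMap.ker g = LinearMap.range f := hfg.linearMap_ker_eq
      rw [hker]
      refine (hfc _).2.trans (Submodule.map_mono ?_)
      have hsub : cthickening b (cthickening c (cthickening (C + 1) (U : Set X))) ⊆
          cthickening (b + (c + (C + 1))) U :=
        (cthickening_subset_of_subset b
          (cthickening_cthickening_subset hc (by positivity) _)).trans
          (cthickening_cthickening_subset hb (by positivity) _)
      refine (E'.mono hsub).trans ?_
      -- An empty member offers no centre for a ball, but contributes only zero.
      rcases (U : Set X).eq_empty_or_nonempty with h | ⟨x, hx⟩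
      · rw [h, cthickening_empty, E'.filt_empty]
        exact bot_le
      · refine (E'.mono fun y hy => ?_).trans (le_iSup (fun x => E'.filt (closedBall x δ)) x)
        obtain ⟨z, hz, hyz⟩ := exists_dist_lt_of_mem_cthickening (by positivity)
          (lt_add_one _) hy
        have h1 := hB i U U.2 z hz x hx
        have h2 := dist_triangle y z x
        rw [mem_closedBall]
        linarith [hβ i, le_abs_self β]
  intro k _
  have hk : f k ∈ LinearMap.ker g ⊓ E.filt (⋃ i, ⋃ U : 𝒰 i, (U : Set X)) := by
    refine ⟨hfg.apply_apply_eq_zero k, ?_⟩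
    have : ⋃ i, ⋃ U : 𝒰 i, (U : Set X) = univ := by
      refine eq_univ_of_forall fun x => ?_
      obtain ⟨i, U, hUi, hx⟩ := hcov x
      exact mem_iUnion.2 ⟨i, mem_iUnion.2 ⟨⟨U, hUi⟩, hx⟩⟩
    rw [this, E.filt_univ]
    exact Submodule.mem_top
  obtain ⟨k', hk', h⟩ := ((hfin _).trans (iSup_le hU')) hk
  exact hf h ▸ hk'
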